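/- **Notation.** A *pair of groups* $(S,S_0)$ is a (small) group $S$ with a subgroup $S_0$, not necessarily normal. $\mathbf{Gp}_2$ is the category of pairs of groups; a morphism $(S,S_0)\to(T,T_0)$ is a group homomorphism $f:S\to T$ with $f(S_0)\subset T_0$, and it is *null* if $f(S)\subset T_0$. $\mathbf Q$ is the category with the same objects, whose morphisms $(S,S_0)\to(T,T_0)$ are the *quasi-homomorphisms*: mappings $f:S\to T$ such that, for all $s_1,\dots,s_n\in S$ and $\varepsilon_i=\pm1$, $s_1^{\varepsilon_1}\cdots s_n^{\varepsilon_n}\in S_0$ implies $f(s_1)^{\varepsilon_1}\cdots f(s_n)^{\varepsilon_n}\in T_0$; again $f$ is null if $f(S)\subset T_0$. The category of *normalised groups* is the quotient $\mathbf{Ngp}=\mathbf Q/\mathcal R$, where $\mathcal R$ is the congruence with $f\,\mathcal R\,g$ if and only if $f(s)g(s)^{-1}\in T_0$ for every $s\in S$; a morphism $[f]$ is null if $f$ is null, which does not depend on the representative. $P:\mathbf{Gp}_2\to\mathbf{Ngp}$ is the canonical functor $(S,S_0)\mapsto(S,S_0)$, $f\mapsto[f]$. $\Sigma$ is the class of *excision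 maps* $p:(S,S_0)\to(T,T_0)$ of $\mathbf{Gp}_2$: those with $p(S)=T$ and $S_0=p^{-1}(T_0)$, i.e. up to isomorphism the projections $(S,S_0)\to(S/N,S_0/N)$ with $N$ normal in $S$ and $N\subset S_0$. A *semiexact category* is a category with a class of null morphisms which is an ideal (stable under composition with arbitrary morphisms on either side) and closed (every null morphism factors through an object whose identity is null), such that every morphism has a kernel and a cokernel with respect to the null morphisms. (A *kernel* of $f$ is a morphism $k$ with $fk$ null such that every $a$ with $fa$ null factors uniquely through $k$; cokernels are dual.) A functor between semiexact categories is *left exact* if it preserves kernels, *right exact* if it preserves cokernels, *exact* if it preserves both, and *short exact* if it preserves short exact sequences, i.e. pairs $(f,g)$ such that $f$ is a kernel of $g$ and $g$ is a cokernel of $f$. **Theorem.** (1) The functor $P:\mathbf{Gp}_2\to\mathbf{Ngp}$ is the category of fractions $\Sigma^{-1}\mathbf{Gp}_2$: it carries every map of $\Sigma$ to an isomorphism, and for every category $\mathbf C$ and every functor $G:\mathbf{Gp}_2\to\mathbf C$ that carries every map of $\Sigma$ to an isomorphism there is exactly one functor $G':\mathbf{Ngp}\to\mathbf C$ with $G'P=G$.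 (2) $\mathbf{Gp}_2$ and $\mathbf{Ngp}$ are semiexact categories, the normal subobjects (classes of kernels) of each of their objects form a small set, and $P$ is exact. (3) $P$ also solves this universal problem within semiexact categories and exact functors: if $\mathbf C$ is a semiexact category and $G:\mathbf{Gp}_2\to\mathbf C$ is an exact functor that carries every map of $\Sigma$ to an isomorphism, then there is exactly one exact functor $G':\mathbf{Ngp}\to\mathbf C$ with $G'P=G$. The same holds with "exact" replaced throughout by "left exact", by "right exact", or by "short exact". -/

import Mathlib

open CategoryTheory

universe u v w

namespace NormalisedGroups

section Semiexact

/-! ### Semiexact categories and their functors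

A class `N` of "null" morphisms is a `MorphismProperty`. Kernels and cokernels are taken
with respect to `N`. -/

variable {C : Type*} [Category C] (N : MorphismProperty C)

/-- `k` is a kernel of `f` with respect to the null morphisms `N`: the composite `k ≫ f` is null,
and every `a` with `a ≫ f` null factors uniquely through `k`. -/
structure IsKernel {K X Y : C} (k : K ⟶ X) (f : X ⟶ Y) : Prop where
  null : N (k ≫ f)
  lift : ∀ ⦃A : C⦄ (a : A ⟶ X), N (a ≫ f) → ∃! b : A ⟶ K, b ≫ k = a

/-- `c` is a cokernel of `f` with respect to the null morphisms `N`. -/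
structure IsCokernel {X Y Z : C} (c : Y ⟶ Z) (f : X ⟶ Y) : Prop where
  null : N (f ≫ c)
  desc : ∀ ⦃A : C⦄ (a : Y ⟶ A), N (f ≫ a) → ∃! b : Z ⟶ A, c ≫ b = a

/-- `(C, N)` is a semiexact category: `N` is a closed ideal, and every morphism has a
kernel and a cokernel with respect to `N`. -/
structure IsSemiexact : Prop where
  comp_right : ∀ ⦃X Y Z : C⦄ (f : X ⟶ Y) (g : Y ⟶ Z), N f → N (f ≫ g)
  comp_left : ∀ ⦃X Y Z : C⦄ (f : X ⟶ Y) (g : Y ⟶ Z), N g → N (f ≫ g)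
  closed : ∀ ⦃X Y : C⦄ (f : X ⟶ Y), N f →
    ∃ (Z : C) (a : X ⟶ Z) (b : Z ⟶ Y), N (𝟙 Z) ∧ a ≫ b = f
  exists_kernel : ∀ ⦃X Y : C⦄ (f : X ⟶ Y), ∃ (K : C) (k : K ⟶ X), IsKernel N k f
  exists_cokernel : ∀ ⦃X Y : C⦄ (f : X ⟶ Y), ∃ (Z : C) (c : Y ⟶ Z), IsCokernel N c f

/-- A normal monomorphism is a kernel of some morphism. -/
def IsNormalMono {K X : C} (k : K ⟶ X) : Prop :=
  ∃ (Y : C) (f : X ⟶ Y), IsKernel N k f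

/-- The normal subobjects of each object form a set which is small relative to the universe `u`. -/
def HasSmallNormalSubobjects : Prop :=
  ∀ X : C, Small.{u} {x : Subobject X // IsNormalMono N x.arrow}

/-- A sequence `(f, g)` is short exact if `f` is a kernel of `g` and `g` is a cokernel of `f`. -/
def IsShortExact {X Y Z : C} (f : X ⟶ Y) (g : Y ⟶ Z) : Prop :=
  IsKernel N f g ∧ IsCokernel N g f

variable {D : Type*} [Category D] (N' : MorphismProperty D) (F : C ⥤ D)

/-- A left exact functor preserves kernels. -/
def IsLeftExact : Prop :=
  ∀ ⦃K X Y : C⦄ (k : K ⟶ X) (f : X ⟶ Y), IsKernel N k f → IsKernel N' (F.map k) (F.map f)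

/-- A right exact functor preserves cokernels. -/
def IsRightExact : Prop :=
  ∀ ⦃X Y Z : C⦄ (c : Y ⟶ Z) (f : X ⟶ Y), IsCokernel N c f → IsCokernel N' (F.map c) (F.map f)

/-- An exact functor preserves kernels and cokernels. -/
def IsExact : Prop :=
  IsLeftExact N N' F ∧ IsRightExact N N' F

/-- A short exact functor preserves short exact sequences. -/
def PreservesShortExact : Prop :=
  ∀ ⦃X Y Z : C⦄ (f : X ⟶ Y) (g : Y ⟶ Z), IsShortExact N f g →
    IsShortExact N' (F.map f) (F.map g)

end Semiexact

/-! ### Pairs of groups -/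

/-- A pair of groups `(S, S₀)`: a group (written multiplicatively) with a subgroup, not
necessarily normal. -/
structure GroupPair : Type (u + 1) where
  carrier : Type u
  [group : Group carrier]
  sub : Subgroup carrier

attribute [instance] GroupPair.group

/-- A morphism of pairs `(S, S₀) ⟶ (T, T₀)`: a homomorphism `S → T` mapping `S₀` into `T₀`. -/
@[ext]
structure GroupPair.Hom (X Y : GroupPair.{u}) : Type u where
  toMonoidHom : X.carrier →* Y.carrier
  map_mem : ∀ s ∈ X.sub, toMonoidHom s ∈ Y.sub

/-- The category `Gp₂` of pairs of groups. -/
instance : Category GroupPair.{u} where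
  Hom := GroupPair.Hom
  id X := ⟨MonoidHom.id _, fun _ h => h⟩
  comp f g := ⟨g.toMonoidHom.comp f.toMonoidHom, fun s h => g.map_mem _ (f.map_mem s h)⟩

/-- A morphism `(S, S₀) ⟶ (T, T₀)` of `Gp₂` is null if it maps `S` into `T₀`. -/
def nullGroupPair : MorphismProperty GroupPair.{u} :=
  fun X Y f => ∀ s : X.carrier, GroupPair.Hom.toMonoidHom f s ∈ Y.sub

/-- The class `Σ` of excision maps `p : (S, S₀) ⟶ (T, T₀)`: those with `p(S) = T` and
`S₀ = p⁻¹(T₀)`. Up to isomorphism they are the projections `(S, S₀) ⟶ (S/N, S₀/N)` with `N`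
normal in `S` and contained in `S₀`. -/
def excision : MorphismProperty GroupPair.{u} :=
  fun X Y p => Function.Surjective (GroupPair.Hom.toMonoidHom p) ∧
    X.sub = Y.sub.comap (GroupPair.Hom.toMonoidHom p)

/-! ### Quasi-homomorphisms -/

/-- For a mapping `f : S → T` into a group and a list of pairs `(sᵢ, εᵢ)`, the ordered product of
the `f(sᵢ)^{±1}`, the sign being `+` for `εᵢ = true` and `-` for `εᵢ = false`. -/
def signedProd {S T : Type u} [Group T] (f : S → T) (l : List (S × Bool)) : T :=
  (l.map fun x => cond x.2 (f x.1) (f x.1)⁻¹).prod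

theorem signedProd_comp {S T U : Type u} [Group U] (f : S → T) (g : T → U)
    (l : List (S × Bool)) :
    signedProd (g ∘ f) l = signedProd g (l.map fun x => (f x.1, x.2)) := by
  simp [signedProd, Function.comp_def]

theorem signedProd_hom {S T U : Type u} [Group T] [Group U] (f : S → T) (g : T →* U)
    (l : List (S × Bool)) :
    signedProd (g ∘ f) l = g (signedProd f l) := by
  induction l with
  | nil => simp [signedProd]
  | cons x l ih => rcases x with ⟨s, _ | _⟩ <;> simp_all [signedProd]

/-- A quasi-homomorphism `(S, S₀) → (T, T₀)`: a mapping `f : S → T` such that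
`s₁^{±1} ⋯ sₙ^{±1} ∈ S₀` implies `f(s₁)^{±1} ⋯ f(sₙ)^{±1} ∈ T₀` (with the same signs). -/
@[ext]
structure QuasiHom (X Y : GroupPair.{u}) : Type u where
  toFun : X.carrier → Y.carrier
  signedProd_mem : ∀ l : List (X.carrier × Bool),
    signedProd id l ∈ X.sub → signedProd toFun l ∈ Y.sub

/-- The objects of the category `Q`: again the pairs of groups. -/
structure QPair : Type (u + 1) where
  pair : GroupPair.{u}

/-- The category `Q` of pairs of groups and quasi-homomorphisms. -/
instance : Category QPair.{u} where
  Hom X Y := QuasiHom X.pair Y.pair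
  id X := ⟨id, fun _ h => h⟩
  comp f g := ⟨g.toFun ∘ f.toFun, fun l h => by
    rw [signedProd_comp]
    apply g.signedProd_mem
    rw [← signedProd_comp]
    exact f.signedProd_mem l h⟩

/-- A quasi-homomorphism `(S, S₀) ⟶ (T, T₀)` is null if it maps `S` into `T₀`. -/
def nullQ : MorphismProperty QPair.{u} :=
  fun X Y f => ∀ s : X.pair.carrier, QuasiHom.toFun f s ∈ Y.pair.sub

/-- The embedding of `Gp₂` in `Q`. -/
def inclQ : GroupPair.{u} ⥤ QPair.{u} where
  obj X := ⟨X⟩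
  map {X Y} f := (⟨GroupPair.Hom.toMonoidHom f, fun l h => by
    have := signedProd_hom id (GroupPair.Hom.toMonoidHom f) l
    rw [Function.comp_id] at this
    rw [this]
    exact GroupPair.Hom.map_mem f _ h⟩ : QuasiHom X Y)

/-! ### Normalised groups -/

/-- The congruence `R` of `Q`: quasi-homomorphisms `f, g : (S, S₀) ⟶ (T, T₀)` are equivalent if
`f(s) g(s)⁻¹ ∈ T₀` for every `s ∈ S`. -/
def relR : HomRel QPair.{u} :=
  fun X Y f g => ∀ s : X.pair.carrier,
    QuasiHom.toFun f s * (QuasiHom.toFun g s)⁻¹ ∈ Y.pair.sub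

instance : Congruence relR.{u} where
  equivalence {X Y} :=
    { refl := fun f s => by simp
      symm := fun h s => by simpa using inv_mem (h s)
      trans := fun h h' s => by simpa using mul_mem (h s) (h' s) }
  comp_left f _ _ h s := h (QuasiHom.toFun f s)
  comp_right {X Y Z f f'} g h s := by
    have := QuasiHom.signedProd_mem g
      [(QuasiHom.toFun f s, true), (QuasiHom.toFun f' s, false)] (by simpa [signedProd] using h s)
    simp only [signedProd, List.map_cons, List.map_nil, List.prod_cons, List.prod_nil, mul_one,
      cond_true, cond_false] at this
    exact this

/-- The category `Ngp = Q / R` of normalised groups. -/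
abbrev Ngp : Type (u + 1) := Quotient relR.{u}

/-- A morphism `[f]` of `Ngp` is null if it has a null representative in `Q`. -/
def nullNgp : MorphismProperty Ngp.{u} :=
  fun X Y φ => ∃ f : X.as ⟶ Y.as, nullQ f ∧ (Quotient.functor relR).map f = φ

/-- Being null does not depend on the chosen representative. -/
theorem nullNgp_map_iff {X Y : QPair.{u}} (f : X ⟶ Y) :
    nullNgp ((Quotient.functor relR).map f) ↔ nullQ f := by
  constructor
  · rintro ⟨g, hg, h⟩ s
    have h' : relR g f := (Quotient.functor_map_eq_iff relR g f).1 h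
    have hg' : QuasiHom.toFun g s ∈ Y.pair.sub := hg s
    have h₂ := mul_mem (inv_mem (h' s)) hg'
    rwa [mul_inv_rev, inv_inv, inv_mul_cancel_right] at h₂
  · intro h
    exact ⟨f, h, rfl⟩

/-- The canonical functor `P : Gp₂ ⥤ Ngp`, `(S, S₀) ↦ (S, S₀)`, `f ↦ [f]`. -/
def functorP : GroupPair.{u} ⥤ Ngp.{u} :=
  inclQ ⋙ Quotient.functor relR

end NormalisedGroups

open NormalisedGroups

/-! Everything rests on the free cover of a pair `(S, S₀)`: the free group on the set `S`, with the
words whose value lies in `S₀`. Evaluation `coverπ` is an excision map, and a mapping `f : S → T` is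
a quasi-homomorphism precisely when its extension to the free group is a morphism of pairs
`f.extend`. In `Ngp` this gives `[f] = P(coverπ)⁻¹ P(f.extend)` (`map_coverπ_comp_toNgp`), so a
functor on `Ngp` is determined by its composite with `P`.

Conversely, if `G` inverts excision maps, `[f] ↦ G(coverπ)⁻¹ G(f.extend)` is the required
factorisation. Invariance under the congruence (`map_extend_eq`) uses the free group on two copies
of `S`: equivalent `f` and `g` together define a morphism on it, and `G` cannot tell the two copies
apart. `P` itself inverts an excision map because any set-theoretic section is a quasi-homomorphism
(`isInvertedBy_functorP`).

The explicit kernels and cokernels of `Gp₂` stay kernels and cokernels in `Ngp`, so `P` is exact. As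
every morphism of `Ngp` is isomorphic to some `P(g)`, semiexactness passes to `Ngp`, and each kind
of exactness passes from `G` to `G'`. -/

namespace NormalisedGroups

/-! ### Kernels and cokernels relative to a class of null morphisms. -/

section General

variable {C : Type*} [Category C] {N : MorphismProperty C}

theorem respectsIso_of_ideal (hl : ∀ ⦃X Y Z : C⦄ (f : X ⟶ Y) (g : Y ⟶ Z), N g → N (f ≫ g))
    (hr : ∀ ⦃X Y Z : C⦄ (f : X ⟶ Y) (g : Y ⟶ Z), N f → N (f ≫ g)) : N.RespectsIso where
  precomp _ _ _ hg := hl _ _ hg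
  postcomp _ _ _ hf := hr _ _ hf

theorem IsKernel.of_iso [N.RespectsIso] {K X Y K' X' Y' : C} {k : K ⟶ X} {f : X ⟶ Y}
    (h : IsKernel N k f) {k' : K' ⟶ X'} {f' : X' ⟶ Y'} (eK : K' ≅ K) (eX : X' ≅ X) (eY : Y' ≅ Y)
    (hk : k' ≫ eX.hom = eK.hom ≫ k) (hf : f' ≫ eY.hom = eX.hom ≫ f) : IsKernel N k' f' where
  null := by
    rw [← N.cancel_right_of_respectsIso _ eY.hom, Category.assoc, hf, reassoc_of% hk,
      N.cancel_left_of_respectsIso]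
    exact h.null
  lift A a ha := by
    rw [← N.cancel_right_of_respectsIso _ eY.hom, Category.assoc, hf, ← Category.assoc] at ha
    obtain ⟨b, hb, hu⟩ := h.lift _ ha
    refine ⟨b ≫ eK.inv, ?_, fun b' hb' => ?_⟩
    · simp [← cancel_mono eX.hom, hk, hb]
    · rw [← hu (b' ≫ eK.hom) (by simp only [Category.assoc, ← hk, reassoc_of% hb'])]
      simp

theorem IsCokernel.of_iso [N.RespectsIso] {X Y Z X' Y' Z' : C} {c : Y ⟶ Z} {f : X ⟶ Y}
    (h : IsCokernel N c f) {c' : Y' ⟶ Z'} {f' : X' ⟶ Y'} (eX : X' ≅ X) (eY : Y' ≅ Y) (eZ : Z' ≅ Z)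
    (hf : f' ≫ eY.hom = eX.hom ≫ f) (hc : c' ≫ eZ.hom = eY.hom ≫ c) : IsCokernel N c' f' where
  null := by
    rw [← N.cancel_right_of_respectsIso _ eZ.hom, Category.assoc, hc, reassoc_of% hf,
      N.cancel_left_of_respectsIso]
    exact h.null
  desc A a ha := by
    have hf' : eX.inv ≫ f' = f ≫ eY.inv := by simp [Iso.inv_comp_eq, ← reassoc_of% hf]
    have hc' : eY.inv ≫ c' = c ≫ eZ.inv := by simp [Iso.inv_comp_eq, ← reassoc_of% hc]
    rw [← N.cancel_left_of_respectsIso eX.inv, reassoc_of% hf'] at ha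
    obtain ⟨b, hb, hu⟩ := h.desc _ ha
    refine ⟨eZ.hom ≫ b, ?_, fun b' hb' => ?_⟩
    · simp [reassoc_of% hc, hb]
    · rw [← hu (eZ.inv ≫ b') (by simp only [← reassoc_of% hc', hb'])]
      simp

/-- A kernel depends only on which morphisms become null after composition. Allowing different
targets `Y` and `Y'` is what makes it possible to count normal subobjects. -/
theorem IsKernel.exists_iso {K K' X Y Y' : C} {k : K ⟶ X} {k' : K' ⟶ X} {f : X ⟶ Y} {f' : X ⟶ Y'}
    (h : IsKernel N k f) (h' : IsKernel N k' f')
    (H : ∀ ⦃A : C⦄ (a : A ⟶ X), N (a ≫ f) ↔ N (a ≫ f')) :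
    ∃ e : K ≅ K', e.hom ≫ k' = k := by
  obtain ⟨b, hb, -⟩ := h'.lift k ((H _).1 h.null)
  obtain ⟨b', hb', -⟩ := h.lift k' ((H _).2 h'.null)
  exact ⟨⟨b, b', (h.lift k h.null).unique (by simp [hb, hb']) (by simp),
    (h'.lift k' h'.null).unique (by simp [hb, hb']) (by simp)⟩, hb⟩

theorem IsCokernel.exists_iso {X Y Z Z' : C} {f : X ⟶ Y} {c : Y ⟶ Z} {c' : Y ⟶ Z'}
    (h : IsCokernel N c f) (h' : IsCokernel N c' f) : ∃ e : Z ≅ Z', c ≫ e.hom = c' := by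
  obtain ⟨b, hb, -⟩ := h.desc c' h'.null
  obtain ⟨b', hb', -⟩ := h'.desc c h.null
  exact ⟨⟨b, b', (h.desc c h.null).unique (by simp [reassoc_of% hb, hb']) (by simp),
    (h'.desc c' h'.null).unique (by simp [reassoc_of% hb', hb]) (by simp)⟩, hb⟩

/-- A kernel is a kernel of each of its cokernels. -/
theorem IsKernel.of_isCokernel (hr : ∀ ⦃X Y Z : C⦄ (f : X ⟶ Y) (g : Y ⟶ Z), N f → N (f ≫ g))
    {K X Y Z : C} {k : K ⟶ X} {f : X ⟶ Y} {c : X ⟶ Z} (h : IsKernel N k f)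
    (hc : IsCokernel N c k) : IsKernel N k c where
  null := hc.null
  lift A a ha := by
    obtain ⟨b, rfl, -⟩ := hc.desc f h.null
    exact h.lift a (by rw [← Category.assoc]; exact hr _ _ ha)

/-- If a kernel of `f` only depends on an invariant of `f` with values in a `u`-small type, then
the normal subobjects form a `u`-small set. -/
theorem hasSmallNormalSubobjects_of_invariant (α : C → Type u)
    (Φ : ∀ {X Y : C}, (X ⟶ Y) → α X)
    (hΦ : ∀ {X Y Y' : C} (f : X ⟶ Y) (f' : X ⟶ Y'), Φ f = Φ f' →
      ∀ ⦃A : C⦄ (a : A ⟶ X), N (a ≫ f) ↔ N (a ≫ f')) :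
    HasSmallNormalSubobjects.{u} N := by
  intro X
  let F : {x : Subobject X // IsNormalMono N x.arrow} → α X := fun x => Φ x.2.choose_spec.choose
  refine small_of_injective (f := F) fun x y hxy => Subtype.ext ?_
  obtain ⟨e, he⟩ := x.2.choose_spec.choose_spec.exists_iso y.2.choose_spec.choose_spec
    (hΦ _ _ hxy)
  exact Subobject.eq_of_comm e he

/-! ### Transfer of exactness along a functor that reaches every morphism up to isomorphism. -/

section Functor

variable {D : Type*} [Category D] {N' : MorphismProperty D} {F : C ⥤ D}

/-- Every morphism of the target is isomorphic to a morphism in the image of the functor. -/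
def LiftsMorphisms (F : C ⥤ D) : Prop :=
  ∀ ⦃X Y : D⦄ (φ : X ⟶ Y), ∃ (X₀ Y₀ : C) (g : X₀ ⟶ Y₀) (eX : X ≅ F.obj X₀) (eY : Y ≅ F.obj Y₀),
    φ ≫ eY.hom = eX.hom ≫ F.map g

theorem isLeftExact_of_exists_kernel [N'.RespectsIso]
    (h : ∀ ⦃X Y : C⦄ (f : X ⟶ Y), ∃ (K : C) (k : K ⟶ X),
      IsKernel N k f ∧ IsKernel N' (F.map k) (F.map f)) : IsLeftExact N N' F := by
  intro K X Y k f hk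
  obtain ⟨K₀, k₀, hk₀, hFk₀⟩ := h f
  obtain ⟨e, he⟩ := hk.exists_iso hk₀ fun _ _ => Iff.rfl
  exact hFk₀.of_iso (F.mapIso e) (Iso.refl _) (Iso.refl _) (by simp [← F.map_comp, he]) (by simp)

theorem isRightExact_of_exists_cokernel [N'.RespectsIso]
    (h : ∀ ⦃X Y : C⦄ (f : X ⟶ Y), ∃ (Z : C) (c : Y ⟶ Z),
      IsCokernel N c f ∧ IsCokernel N' (F.map c) (F.map f)) : IsRightExact N N' F := by
  intro X Y Z c f hc
  obtain ⟨Z₀, c₀, hc₀, hFc₀⟩ := h f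
  obtain ⟨e, he⟩ := hc.exists_iso hc₀
  exact hFc₀.of_iso (Iso.refl _) (Iso.refl _) (F.mapIso e) (by simp) (by simp [← F.map_comp, he])

theorem IsSemiexact.of_liftsMorphisms (hN : IsSemiexact N)
    (hl : ∀ ⦃X Y Z : D⦄ (f : X ⟶ Y) (g : Y ⟶ Z), N' g → N' (f ≫ g))
    (hr : ∀ ⦃X Y Z : D⦄ (f : X ⟶ Y) (g : Y ⟶ Z), N' f → N' (f ≫ g))
    (hF : ∀ ⦃X Y : C⦄ (f : X ⟶ Y), N' (F.map f) ↔ N f) (hex : IsExact N N' F)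
    (hlift : LiftsMorphisms F) : IsSemiexact N' where
  comp_right := hr
  comp_left := hl
  closed X Y φ hφ := by
    obtain ⟨X₀, Y₀, g, eX, eY, h⟩ := hlift φ
    have hg : N g := by
      rw [← hF, ← Iso.inv_comp_eq] at *
      exact h ▸ hl _ _ (hr _ _ hφ)
    obtain ⟨Z, a, b, hZ, rfl⟩ := hN.closed g hg
    refine ⟨F.obj Z, eX.hom ≫ F.map a, F.map b ≫ eY.inv, ?_, ?_⟩
    · rw [← F.map_id]
      exact (hF _).2 hZ
    · simp [← cancel_mono eY.hom, h]
  exists_kernel X Y φ := by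
    have := respectsIso_of_ideal hl hr
    obtain ⟨X₀, Y₀, g, eX, eY, h⟩ := hlift φ
    obtain ⟨K, k, hk⟩ := hN.exists_kernel g
    exact ⟨F.obj K, F.map k ≫ eX.inv,
      (hex.1 _ _ hk).of_iso (Iso.refl _) eX eY (by simp) h⟩
  exists_cokernel X Y φ := by
    have := respectsIso_of_ideal hl hr
    obtain ⟨X₀, Y₀, g, eX, eY, h⟩ := hlift φ
    obtain ⟨Z, c, hc⟩ := hN.exists_cokernel g
    exact ⟨F.obj Z, eY.hom ≫ F.map c,
      (hex.2 _ _ hc).of_iso eX eY (Iso.refl _) h (by simp)⟩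

variable {E : Type*} [Category E] {M : MorphismProperty E} {G : D ⥤ E}

theorem map_comm_of_comm {X Y : D} {X₀ Y₀ : C} {φ : X ⟶ Y} {g : X₀ ⟶ Y₀} {eX : X ≅ F.obj X₀}
    {eY : Y ≅ F.obj Y₀} (h : φ ≫ eY.hom = eX.hom ≫ F.map g) :
    G.map φ ≫ (G.mapIso eY).hom = (G.mapIso eX).hom ≫ (F ⋙ G).map g := by
  simp only [Functor.mapIso_hom, Functor.comp_map, ← G.map_comp, h]

/-- Up to isomorphism `φ` is `F.map g`, and by uniqueness of kernels `κ` is then the image under `F`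
of a kernel of `g`, where the hypothesis on `F ⋙ G` applies. -/
theorem IsLeftExact.of_comp [N'.RespectsIso] [M.RespectsIso] (hN : IsSemiexact N)
    (hF : IsLeftExact N N' F) (hlift : LiftsMorphisms F) (h : IsLeftExact N M (F ⋙ G)) :
    IsLeftExact N' M G := by
  intro K X Y κ φ hκ
  obtain ⟨X₀, Y₀, g, eX, eY, hφ⟩ := hlift φ
  obtain ⟨K₀, k, hk⟩ := hN.exists_kernel g
  obtain ⟨e, he⟩ := hκ.exists_iso (k' := F.map k ≫ eX.inv)
    ((hF _ _ hk).of_iso (Iso.refl _) eX eY (by simp) hφ) fun _ _ => Iff.rfl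
  exact (h _ _ hk).of_iso (G.mapIso e) (G.mapIso eX) (G.mapIso eY)
    (map_comm_of_comm (by simp [← he])) (map_comm_of_comm hφ)

theorem IsRightExact.of_comp [N'.RespectsIso] [M.RespectsIso] (hN : IsSemiexact N)
    (hF : IsRightExact N N' F) (hlift : LiftsMorphisms F) (h : IsRightExact N M (F ⋙ G)) :
    IsRightExact N' M G := by
  intro X Y Z γ φ hγ
  obtain ⟨X₀, Y₀, g, eX, eY, hφ⟩ := hlift φ
  obtain ⟨Z₀, c, hc⟩ := hN.exists_cokernel g
  obtain ⟨e, he⟩ := hγ.exists_iso (c' := eY.hom ≫ F.map c)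
    ((hF _ _ hc).of_iso eX eY (Iso.refl _) hφ (by simp))
  exact (h _ _ hc).of_iso (G.mapIso eX) (G.mapIso eY) (G.mapIso e)
    (map_comm_of_comm hφ) (map_comm_of_comm he)

theorem PreservesShortExact.of_comp [N'.RespectsIso] [M.RespectsIso] (hN : IsSemiexact N)
    (hF : IsExact N N' F) (hlift : LiftsMorphisms F) (h : PreservesShortExact N M (F ⋙ G)) :
    PreservesShortExact N' M G := by
  rintro X Y Z κ γ ⟨hκ, hγ⟩
  obtain ⟨Y₀, Z₀, g, eY, eZ, hg⟩ := hlift γ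
  obtain ⟨X₀, k, hk⟩ := hN.exists_kernel g
  obtain ⟨W₀, c, hc⟩ := hN.exists_cokernel k
  obtain ⟨e, he⟩ := hκ.exists_iso (k' := F.map k ≫ eY.inv)
    ((hF.1 _ _ hk).of_iso (Iso.refl _) eY eZ (by simp) hg) fun _ _ => Iff.rfl
  have hκe : κ ≫ eY.hom = e.hom ≫ F.map k := by simp [← he]
  obtain ⟨e', he'⟩ := hγ.exists_iso (c' := eY.hom ≫ F.map c)
    ((hF.2 _ _ hc).of_iso e eY (Iso.refl _) hκe (by simp))
  -- The lift `g` need not be a cokernel of `k`, so it is replaced by `c`: the pair `(k, c)` is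
  -- short exact in `C`, and its image under `F` is isomorphic to `(κ, γ)`.
  obtain ⟨h₁, h₂⟩ := h _ _ ⟨hk.of_isCokernel hN.comp_right hc, hc⟩
  exact ⟨h₁.of_iso (G.mapIso e) (G.mapIso eY) (G.mapIso e')
      (map_comm_of_comm hκe) (map_comm_of_comm he'),
    h₂.of_iso (G.mapIso e) (G.mapIso eY) (G.mapIso e')
      (map_comm_of_comm hκe) (map_comm_of_comm he')⟩

end Functor

end General

/-! ### Pairs of groups -/

theorem GroupPair.hom_ext {X Y : GroupPair.{u}} {f g : X ⟶ Y}
    (h : ∀ s, GroupPair.Hom.toMonoidHom f s = GroupPair.Hom.toMonoidHom g s) : f = g :=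
  GroupPair.Hom.ext (MonoidHom.ext h)

theorem GroupPair.congr_toMonoidHom {X Y : GroupPair.{u}} {f g : X ⟶ Y} (h : f = g) (s : X.carrier) :
    GroupPair.Hom.toMonoidHom f s = GroupPair.Hom.toMonoidHom g s := by rw [h]

/-- The subgroup `f⁻¹(T₀)` of `S`, for a morphism `f : (S, S₀) ⟶ (T, T₀)`. -/
def GroupPair.preimage {X Y : GroupPair.{u}} (f : X ⟶ Y) : Subgroup X.carrier :=
  Y.sub.comap (GroupPair.Hom.toMonoidHom f)

/-- The pair `(f⁻¹(T₀), S₀)`. -/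
def GroupPair.ker {X Y : GroupPair.{u}} (f : X ⟶ Y) : GroupPair.{u} where
  carrier := preimage f
  sub := X.sub.comap (preimage f).subtype

/-- The inclusion `(f⁻¹(T₀), S₀) ⟶ (S, S₀)`. -/
def GroupPair.kerι {X Y : GroupPair.{u}} (f : X ⟶ Y) : ker f ⟶ X :=
  (⟨(preimage f).subtype, fun _ h => h⟩ : GroupPair.Hom _ _)

/-- The pair `(T, T₀ ⊔ f(S))`. -/
def GroupPair.coker {X Y : GroupPair.{u}} (f : X ⟶ Y) : GroupPair.{u} where
  carrier := Y.carrier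
  sub := Y.sub ⊔ (GroupPair.Hom.toMonoidHom f).range

/-- The morphism `(T, T₀) ⟶ (T, T₀ ⊔ f(S))` given by the identity of `T`. -/
def GroupPair.cokerπ {X Y : GroupPair.{u}} (f : X ⟶ Y) : Y ⟶ coker f :=
  (⟨MonoidHom.id Y.carrier, fun _ h => Subgroup.mem_sup_left h⟩ : GroupPair.Hom Y (coker f))

open GroupPair

theorem isKernel_kerι {X Y : GroupPair.{u}} (f : X ⟶ Y) : IsKernel nullGroupPair (kerι f) f where
  null s := s.2
  lift A a ha := by
    refine ⟨(⟨(GroupPair.Hom.toMonoidHom a).codRestrict (preimage f) ha,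
      fun s h => GroupPair.Hom.map_mem a s h⟩ : GroupPair.Hom _ _), rfl, fun b hb => ?_⟩
    exact GroupPair.hom_ext fun s => Subtype.ext (GroupPair.congr_toMonoidHom hb s)

theorem isCokernel_cokerπ {X Y : GroupPair.{u}} (f : X ⟶ Y) :
    IsCokernel nullGroupPair (cokerπ f) f where
  null s := Subgroup.mem_sup_right (Set.mem_range_self s)
  desc A a ha := by
    have h : Y.sub ⊔ (GroupPair.Hom.toMonoidHom f).range ≤
        A.sub.comap (GroupPair.Hom.toMonoidHom a) := by
      refine sup_le (fun s h => GroupPair.Hom.map_mem a s h) ?_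
      rintro _ ⟨s, rfl⟩
      exact ha s
    let φ : Y.carrier →* A.carrier := GroupPair.Hom.toMonoidHom a
    refine ⟨(⟨φ, h⟩ : GroupPair.Hom (coker f) A), rfl, fun b hb => ?_⟩
    exact GroupPair.hom_ext fun s => GroupPair.congr_toMonoidHom hb s

theorem isSemiexact_nullGroupPair : IsSemiexact nullGroupPair.{u} where
  comp_right _ _ _ _ g h s := GroupPair.Hom.map_mem g _ (h s)
  comp_left _ _ _ f _ h s := h (GroupPair.Hom.toMonoidHom f s)
  closed X Y f hf :=
    -- A pair has null identity exactly when its subgroup is the whole group, hence the middle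
    -- object `(T₀, T₀)`.
    ⟨⟨Y.sub, ⊤⟩, (⟨(GroupPair.Hom.toMonoidHom f).codRestrict Y.sub hf,
      fun _ _ => Subgroup.mem_top _⟩ : GroupPair.Hom X ⟨Y.sub, ⊤⟩),
      (⟨Y.sub.subtype, fun s _ => s.2⟩ : GroupPair.Hom ⟨Y.sub, ⊤⟩ Y), fun _ => Subgroup.mem_top _, rfl⟩
  exists_kernel _ _ f := ⟨_, _, isKernel_kerι f⟩
  exists_cokernel _ _ f := ⟨_, _, isCokernel_cokerπ f⟩

theorem hasSmallNormalSubobjects_nullGroupPair :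
    HasSmallNormalSubobjects.{u} nullGroupPair.{u} :=
  hasSmallNormalSubobjects_of_invariant (fun X => Subgroup X.carrier) preimage
    fun {X _ _} f f' h A a => by
      have key : ∀ s : X.carrier, s ∈ preimage f ↔ s ∈ preimage f' := fun s => by rw [h]
      exact forall_congr' fun s => key (GroupPair.Hom.toMonoidHom a s)

/-! ### Quasi-homomorphisms -/

/-- Signed words represent elements of the free group, so the quasi-homomorphism condition can be
tested there, where homomorphisms are determined by the letters. -/
theorem signedProd_eq_lift {S T : Type u} [Group T] (f : S → T) (l : List (S × Bool)) :
    signedProd f l = FreeGroup.lift f (FreeGroup.mk l) :=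
  FreeGroup.lift_mk.symm

namespace QuasiHom

variable {X Y Z : GroupPair.{u}}

theorem lift_mem (f : QuasiHom X Y) (w : FreeGroup X.carrier)
    (hw : FreeGroup.lift id w ∈ X.sub) : FreeGroup.lift f.toFun w ∈ Y.sub := by
  induction w using Quot.inductionOn with
  | h l =>
    have := f.signedProd_mem l
    simp only [signedProd_eq_lift] at this
    exact this hw

/-- A mapping of groups whose extension to free groups respects the subgroups. -/
def ofLift (f : X.carrier → Y.carrier) (h : ∀ w : FreeGroup X.carrier,
    FreeGroup.lift id w ∈ X.sub → FreeGroup.lift f w ∈ Y.sub) : QuasiHom X Y :=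
  ⟨f, fun l => by simpa only [signedProd_eq_lift] using h (FreeGroup.mk l)⟩

/-- The word `w` followed by the inverse of its value, taken as a single letter, evaluates to `1`.
Hence `f` is multiplicative up to right cosets of `T₀`. -/
theorem lift_mul_inv_mem (f : QuasiHom X Y) (w : FreeGroup X.carrier) :
    FreeGroup.lift f.toFun w * (f.toFun (FreeGroup.lift id w))⁻¹ ∈ Y.sub := by
  simpa using f.lift_mem (w * (FreeGroup.of (FreeGroup.lift id w))⁻¹) (by simp)

theorem mul_mul_inv_mem (f : QuasiHom X Y) (s t : X.carrier) :
    f.toFun s * f.toFun t * (f.toFun (s * t))⁻¹ ∈ Y.sub := by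
  simpa using f.lift_mul_inv_mem (FreeGroup.of s * FreeGroup.of t)

/-- The composite of quasi-homomorphisms. -/
def comp (f : QuasiHom X Y) (g : QuasiHom Y Z) : QuasiHom X Z :=
  (show QPair.mk X ⟶ QPair.mk Y from f) ≫ (show QPair.mk Y ⟶ QPair.mk Z from g)

/-- A morphism of pairs of groups, as a quasi-homomorphism. -/
def ofHom (f : X ⟶ Y) : QuasiHom X Y := inclQ.map f

theorem mul_inv_mem_symm {G : Type*} [Group G] {H : Subgroup G} {a b : G} (h : a * b⁻¹ ∈ H) :
    b * a⁻¹ ∈ H := by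
  simpa using inv_mem h

theorem mem_iff_of_mul_inv_mem {G : Type*} [Group G] {H : Subgroup G} {a b : G}
    (h : a * b⁻¹ ∈ H) : a ∈ H ↔ b ∈ H := by
  rw [← H.mul_mem_cancel_left h (y := b), inv_mul_cancel_right]

/-- The preimage of `T₀` along a quasi-homomorphism `(S, S₀) → (T, T₀)`. -/
def preimage (f : QuasiHom X Y) : Subgroup X.carrier where
  carrier := {s | f.toFun s ∈ Y.sub}
  one_mem' := by simpa using (mem_iff_of_mul_inv_mem (f.lift_mul_inv_mem 1)).1
  mul_mem' {s t} hs ht := (mem_iff_of_mul_inv_mem (f.mul_mul_inv_mem s t)).1 (mul_mem hs ht)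
  inv_mem' {s} hs := by
    have := f.lift_mul_inv_mem (FreeGroup.of s)⁻¹
    simp only [map_inv, FreeGroup.lift_apply_of, id] at this
    exact (mem_iff_of_mul_inv_mem this).1 (inv_mem hs)

theorem sub_le_preimage (f : QuasiHom X Y) : X.sub ≤ f.preimage := fun s hs => by
  have := f.lift_mem (FreeGroup.of s) (by simpa using hs)
  rwa [FreeGroup.lift_apply_of] at this

theorem lift_mem_iff (f : QuasiHom X Y) (w : FreeGroup X.carrier) :
    FreeGroup.lift f.toFun w ∈ Y.sub ↔ FreeGroup.lift id w ∈ f.preimage :=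
  mem_iff_of_mul_inv_mem (f.lift_mul_inv_mem w)

/-- Words mixing two equivalent quasi-homomorphisms `f` and `g` are congruent to values of `f`. -/
theorem mul_lift_elim_mul_inv_mem {f g : QuasiHom X Y}
    (h : ∀ s, f.toFun s * (g.toFun s)⁻¹ ∈ Y.sub) (w : FreeGroup (X.carrier ⊕ X.carrier)) :
    ∀ s, f.toFun s * FreeGroup.lift (Sum.elim f.toFun g.toFun) w *
      (f.toFun (s * FreeGroup.lift (Sum.elim id id) w))⁻¹ ∈ Y.sub := by
  have hof : ∀ (x : X.carrier ⊕ X.carrier) (s : X.carrier), f.toFun s *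
      FreeGroup.lift (Sum.elim f.toFun g.toFun) (FreeGroup.of x) *
      (f.toFun (s * FreeGroup.lift (Sum.elim id id) (FreeGroup.of x)))⁻¹ ∈ Y.sub := by
    rintro (x | x) s
    · simpa using f.mul_mul_inv_mem s x
    -- Telescoping: replace `f s` by `g s`, multiply inside `g`, then return from `g (s * x)` to `f
    -- (s * x)`.
    · simpa [mul_assoc] using mul_mem (mul_mem (h s) (g.mul_mul_inv_mem s x))
        (mul_inv_mem_symm (h (s * x)))
  -- The prefix `s` stays quantified because `T₀` is not normal: congruences extend on the right
  -- only, so the second factor of a product needs the value of the first as part of its prefix.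
  induction w using FreeGroup.induction_on with
  | C1 => simp
  | of x => exact hof x
  | inv_of x _ =>
    intro s
    simpa [mul_assoc] using
      inv_mem (hof x (s * (FreeGroup.lift (Sum.elim id id) (FreeGroup.of x))⁻¹))
  | mul v w hv hw =>
    intro s
    simpa [mul_assoc] using
      mul_mem (hv s) (hw (s * FreeGroup.lift (Sum.elim id id) v))

end QuasiHom

/-! ### Free covers -/

/-- The free group on the underlying set of `S`, with the subgroup of words with value in `S₀`. -/
def cover (X : GroupPair.{u}) : GroupPair.{u} where
  carrier := FreeGroup X.carrier
  sub := X.sub.comap (FreeGroup.lift id)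

/-- The evaluation of words. -/
def coverπ (X : GroupPair.{u}) : cover X ⟶ X :=
  (⟨FreeGroup.lift id, fun _ h => h⟩ : GroupPair.Hom (cover X) X)

theorem excision_coverπ (X : GroupPair.{u}) : excision (coverπ X) :=
  ⟨fun s => ⟨FreeGroup.of s, FreeGroup.lift_apply_of⟩, rfl⟩

/-- The extension of a quasi-homomorphism to the free cover. -/
def QuasiHom.extend {X Y : GroupPair.{u}} (f : QuasiHom X Y) : cover X ⟶ Y :=
  (⟨FreeGroup.lift f.toFun, f.lift_mem⟩ : GroupPair.Hom (cover X) Y)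

theorem lift_map {S T G : Type*} [Group G] (f : S → T) (g : T → G) (w : FreeGroup S) :
    FreeGroup.lift g (FreeGroup.map f w) = FreeGroup.lift (g ∘ f) w := by
  rw [← MonoidHom.comp_apply]
  congr 1
  exact FreeGroup.ext_hom _ _ fun s => by simp

/-- The homomorphism of free covers induced by a quasi-homomorphism. -/
def QuasiHom.coverMap {X Y : GroupPair.{u}} (f : QuasiHom X Y) : cover X ⟶ cover Y :=
  (⟨FreeGroup.map f.toFun, fun w hw => by
    have := f.lift_mem w hw
    exact (congrArg (· ∈ Y.sub) (lift_map f.toFun id w)).mpr this⟩ : GroupPair.Hom (cover X) (cover Y))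

theorem cover_hom_ext {X Y : GroupPair.{u}} {f g : cover X ⟶ Y}
    (h : ∀ s : X.carrier, GroupPair.Hom.toMonoidHom f (FreeGroup.of s) =
      GroupPair.Hom.toMonoidHom g (FreeGroup.of s)) : f = g :=
  GroupPair.Hom.ext (FreeGroup.ext_hom _ _ h)

/-- Together with `coverMap_comp_coverπ`, this is what makes the fractions `G(coverπ)⁻¹ G(f.extend)`
compose. -/
theorem coverMap_comp_extend {X Y Z : GroupPair.{u}} (f : QuasiHom X Y) (g : QuasiHom Y Z) :
    f.coverMap ≫ g.extend = (f.comp g).extend :=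
  cover_hom_ext fun s => by
    change FreeGroup.lift g.toFun (FreeGroup.map f.toFun (FreeGroup.of s)) =
      FreeGroup.lift (g.toFun ∘ f.toFun) (FreeGroup.of s)
    simp

theorem coverMap_comp_coverπ {X Y : GroupPair.{u}} (f : QuasiHom X Y) :
    f.coverMap ≫ coverπ Y = f.extend :=
  cover_hom_ext fun s => by
    change FreeGroup.lift id (FreeGroup.map f.toFun (FreeGroup.of s)) =
      FreeGroup.lift f.toFun (FreeGroup.of s)
    simp

theorem extend_ofHom {X Y : GroupPair.{u}} (f : X ⟶ Y) :
    (QuasiHom.ofHom f).extend = coverπ X ≫ f :=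
  cover_hom_ext fun s => by
    change FreeGroup.lift (GroupPair.Hom.toMonoidHom f) (FreeGroup.of s) =
      GroupPair.Hom.toMonoidHom f (FreeGroup.lift id (FreeGroup.of s))
    simp

/-- The free group on two copies of `S`, with the subgroup of words with value in `S₀`. -/
def doubleCover (X : GroupPair.{u}) : GroupPair.{u} where
  carrier := FreeGroup (X.carrier ⊕ X.carrier)
  sub := X.sub.comap (FreeGroup.lift (Sum.elim id id))

/-- The evaluation of words in two copies of `S`. -/
def doubleCoverπ (X : GroupPair.{u}) : doubleCover X ⟶ X :=
  (⟨FreeGroup.lift (Sum.elim id id), fun _ h => h⟩ : GroupPair.Hom (doubleCover X) X)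

theorem excision_doubleCoverπ (X : GroupPair.{u}) : excision (doubleCoverπ X) :=
  ⟨fun s => ⟨FreeGroup.of (Sum.inl s), FreeGroup.lift_apply_of⟩, rfl⟩

/-- The embedding of the free cover as words in one of the two copies. -/
def doubleCoverι {X : GroupPair.{u}} (i : X.carrier → X.carrier ⊕ X.carrier)
    (hi : Sum.elim id id ∘ i = id) : cover X ⟶ doubleCover X :=
  (⟨FreeGroup.map i, fun w hw => by
    have h : FreeGroup.lift (Sum.elim id id ∘ i) w ∈ X.sub := by
      rw [hi]
      exact hw
    exact (congrArg (· ∈ X.sub) (lift_map i (Sum.elim id id) w)).mpr h⟩ : GroupPair.Hom (cover X) (doubleCover X))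

/-- Two equivalent quasi-homomorphisms define a homomorphism on the double cover. -/
def doubleExtend {X Y : GroupPair.{u}} (f g : QuasiHom X Y)
    (h : ∀ s, f.toFun s * (g.toFun s)⁻¹ ∈ Y.sub) : doubleCover X ⟶ Y :=
  (⟨FreeGroup.lift (Sum.elim f.toFun g.toFun), fun w hw => by
    -- With prefix `1`, the mixed word preceded by `f 1` is congruent to `f` of its value, which
    -- lies in `T₀`; and `f 1 ∈ T₀` cancels.
    have h₁ := QuasiHom.mul_lift_elim_mul_inv_mem h w 1
    rw [one_mul] at h₁
    have h₂ := (QuasiHom.mem_iff_of_mul_inv_mem h₁).2 (f.sub_le_preimage hw)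
    exact (Y.sub.mul_mem_cancel_left (one_mem f.preimage)).1 h₂⟩ :
    GroupPair.Hom (doubleCover X) Y)

/-- A functor inverting excision maps identifies equivalent quasi-homomorphisms. -/
theorem map_extend_eq {C : Type*} [Category C] {G : GroupPair.{u} ⥤ C}
    (hG : excision.IsInvertedBy G) {X Y : GroupPair.{u}} (f g : QuasiHom X Y)
    (h : ∀ s, f.toFun s * (g.toFun s)⁻¹ ∈ Y.sub) : G.map f.extend = G.map g.extend := by
  have := hG _ (excision_doubleCoverπ X)
  -- Both embeddings followed by evaluation give the evaluation of the free cover, and `G` makes the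
  -- evaluation of the double cover invertible.
  have hi : G.map (doubleCoverι (X := X) Sum.inl rfl) = G.map (doubleCoverι Sum.inr rfl) := by
    rw [← cancel_mono (G.map (doubleCoverπ X)), ← G.map_comp, ← G.map_comp]
    congr 1
    exact cover_hom_ext fun s => by
      change FreeGroup.lift _ (FreeGroup.map _ (FreeGroup.of s)) =
        FreeGroup.lift _ (FreeGroup.map _ (FreeGroup.of s))
      simp
  have hf : f.extend = doubleCoverι Sum.inl rfl ≫ doubleExtend f g h :=
    cover_hom_ext fun s => by
      change FreeGroup.lift _ (FreeGroup.of s) =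
        FreeGroup.lift _ (FreeGroup.map _ (FreeGroup.of s))
      simp
  have hg : g.extend = doubleCoverι Sum.inr rfl ≫ doubleExtend f g h :=
    cover_hom_ext fun s => by
      change FreeGroup.lift _ (FreeGroup.of s) =
        FreeGroup.lift _ (FreeGroup.map _ (FreeGroup.of s))
      simp
  rw [hf, hg, G.map_comp, G.map_comp, hi]

/-! ### The category of fractions -/

/-- The class in `Ngp` of a quasi-homomorphism. -/
def QuasiHom.toNgp {X Y : GroupPair.{u}} (f : QuasiHom X Y) : functorP.obj X ⟶ functorP.obj Y :=
  (CategoryTheory.Quotient.functor relR).map (X := ⟨X⟩) (Y := ⟨Y⟩) f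

theorem toNgp_comp {X Y Z : GroupPair.{u}} (f : QuasiHom X Y) (g : QuasiHom Y Z) :
    (f.comp g).toNgp = f.toNgp ≫ g.toNgp :=
  (CategoryTheory.Quotient.functor relR).map_comp (X := ⟨X⟩) (Y := ⟨Y⟩) (Z := ⟨Z⟩) f g

theorem functorP_map {X Y : GroupPair.{u}} (f : X ⟶ Y) :
    functorP.map f = (QuasiHom.ofHom f).toNgp := rfl

theorem toNgp_eq_iff {X Y : GroupPair.{u}} {f g : QuasiHom X Y} :
    f.toNgp = g.toNgp ↔ ∀ s, f.toFun s * (g.toFun s)⁻¹ ∈ Y.sub :=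
  CategoryTheory.Quotient.functor_map_eq_iff relR (X := ⟨X⟩) (Y := ⟨Y⟩) f g

theorem exists_toNgp_eq {X Y : GroupPair.{u}} (φ : functorP.obj X ⟶ functorP.obj Y) :
    ∃ f : QuasiHom X Y, f.toNgp = φ :=
  let F := CategoryTheory.Quotient.functor relR.{u}
  let φ' : F.obj ⟨X⟩ ⟶ F.obj ⟨Y⟩ := φ
  F.map_surjective φ'

theorem nullNgp_toNgp_iff {X Y : GroupPair.{u}} (f : QuasiHom X Y) :
    nullNgp f.toNgp ↔ ∀ s, s ∈ f.preimage :=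
  nullNgp_map_iff (X := ⟨X⟩) (Y := ⟨Y⟩) f

theorem nullNgp_functorP_map_iff ⦃X Y : GroupPair.{u}⦄ (f : X ⟶ Y) :
    nullNgp (functorP.map f) ↔ nullGroupPair f :=
  nullNgp_toNgp_iff (QuasiHom.ofHom f)

/-- The inverse is the class of any set-theoretic section: applying `p` to a word in its values
recovers the value of the original word, and `S₀ = p⁻¹(T₀)`. The composite on `S` moves elements
only within cosets of the kernel of `p`, which lies in `S₀`. -/
theorem isInvertedBy_functorP : excision.{u}.IsInvertedBy functorP.{u} := by
  rintro X Y p ⟨hp, hsub⟩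
  have hp' := Function.surjInv_eq hp
  have hlift : ∀ w, GroupPair.Hom.toMonoidHom p (FreeGroup.lift (Function.surjInv hp) w) =
      FreeGroup.lift id w := by
    intro w
    rw [← MonoidHom.comp_apply]
    congr 1
    exact FreeGroup.ext_hom _ _ fun s => by simp [hp']
  let q : QuasiHom Y X := QuasiHom.ofLift (Function.surjInv hp) fun w hw => by
    rwa [hsub, Subgroup.mem_comap, hlift]
  refine ⟨q.toNgp, ?_, ?_⟩
  · rw [← functorP.map_id, functorP_map, functorP_map, ← toNgp_comp, toNgp_eq_iff]
    intro s
    change Function.surjInv hp (GroupPair.Hom.toMonoidHom p s) * s⁻¹ ∈ X.sub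
    rw [hsub, Subgroup.mem_comap, map_mul, hp', map_inv, mul_inv_cancel]
    exact one_mem _
  · rw [← functorP.map_id, functorP_map, functorP_map, ← toNgp_comp, toNgp_eq_iff]
    intro s
    change GroupPair.Hom.toMonoidHom p (Function.surjInv hp s) * s⁻¹ ∈ Y.sub
    rw [hp', mul_inv_cancel]
    exact one_mem _

/-- In `Ngp`, a quasi-homomorphism is the fraction of its extension by the free cover. -/
theorem map_coverπ_comp_toNgp {X Y : GroupPair.{u}} (f : QuasiHom X Y) :
    functorP.map (coverπ X) ≫ f.toNgp = functorP.map f.extend := by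
  rw [functorP_map, functorP_map, ← toNgp_comp, toNgp_eq_iff]
  exact fun w => QuasiHom.mul_inv_mem_symm (f.lift_mul_inv_mem w)

theorem liftsMorphisms_functorP : LiftsMorphisms functorP.{u} := by
  rintro ⟨⟨X⟩⟩ ⟨⟨Y⟩⟩ φ
  obtain ⟨f, rfl⟩ := exists_toNgp_eq φ
  have := isInvertedBy_functorP _ (excision_coverπ X)
  refine ⟨cover X, Y, f.extend, (asIso (functorP.map (coverπ X))).symm, Iso.refl _, ?_⟩
  rw [← map_coverπ_comp_toNgp]
  exact (Category.comp_id _).trans (IsIso.inv_hom_id_assoc (functorP.map (coverπ X)) _).symm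

section Lift

variable {C : Type*} [Category C] (G : GroupPair.{u} ⥤ C) (hG : excision.IsInvertedBy G)

/-- The functor on `Q` induced by a functor on `Gp₂` inverting excision maps. -/
noncomputable def liftQ : QPair.{u} ⥤ C where
  obj X := G.obj X.pair
  map {X _} f :=
    have := hG _ (excision_coverπ X.pair)
    inv (G.map (coverπ X.pair)) ≫ G.map (QuasiHom.extend f)
  map_id X := by
    have := hG _ (excision_coverπ X.pair)
    exact IsIso.inv_hom_id (G.map (coverπ X.pair))
  map_comp {X Y Z} f g := by
    have := hG _ (excision_coverπ X.pair)
    have := hG _ (excision_coverπ Y.pair)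
    have h₁ : QuasiHom.extend (f ≫ g) = _ := (coverMap_comp_extend f g).symm
    have h₂ : QuasiHom.extend f = _ := (coverMap_comp_coverπ f).symm
    rw [h₁, h₂]
    simp

/-- The functor on `Ngp` induced by a functor on `Gp₂` inverting excision maps. -/
noncomputable def liftNgp : Ngp.{u} ⥤ C :=
  CategoryTheory.Quotient.lift relR (liftQ G hG) fun X _ f g h => by
    have := hG _ (excision_coverπ X.pair)
    change inv (G.map (coverπ X.pair)) ≫ G.map (QuasiHom.extend f) =
      inv (G.map (coverπ X.pair)) ≫ G.map (QuasiHom.extend g)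
    rw [map_extend_eq hG f g h]

theorem functorP_comp_liftNgp : functorP ⋙ liftNgp G hG = G := by
  refine CategoryTheory.Functor.ext (fun _ => rfl) fun X Y f => ?_
  have := hG _ (excision_coverπ X)
  change inv (G.map (coverπ X)) ≫ G.map (QuasiHom.ofHom f).extend = 𝟙 _ ≫ G.map f ≫ 𝟙 _
  rw [extend_ofHom]
  simp

end Lift

theorem eqToHom_conj_comp {C : Type*} [Category C] {X Y Z X' Y' Z' : C} (p : X' = X) (q : Y = Y')
    (q' : Y' = Y) (r : Z = Z') (f : X ⟶ Y) (g : Y ⟶ Z) : eqToHom p ≫ (f ≫ g) ≫ eqToHom r =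
      (eqToHom p ≫ f ≫ eqToHom q) ≫ eqToHom q' ≫ g ≫ eqToHom r := by
  subst p q r
  simp

/-- Both functors agree on `P(coverπ)` and `P(f.extend)`; cancelling the invertible first map forces
agreement on `[f]`. Equality of functors is strict, so morphisms are compared after conjugation by
`eqToHom`. -/
theorem functorP_comp_injective {C : Type*} [Category C] {F F' : Ngp.{u} ⥤ C}
    (h : functorP ⋙ F = functorP ⋙ F') : F = F' := by
  refine CategoryTheory.Functor.ext
    (fun X : Ngp => CategoryTheory.Functor.congr_obj h X.as.pair) ?_
  rintro ⟨⟨X⟩⟩ ⟨⟨Y⟩⟩ φ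
  obtain ⟨f, rfl⟩ := exists_toNgp_eq φ
  have := isInvertedBy_functorP _ (excision_coverπ X)
  have h₁ := CategoryTheory.Functor.congr_hom h (coverπ X)
  have h₂ := CategoryTheory.Functor.congr_hom h f.extend
  simp only [Functor.comp_map] at h₁ h₂
  refine (cancel_epi (F.map (functorP.map (coverπ X)))).1 ?_
  have e := congrArg F.map (map_coverπ_comp_toNgp f)
  have e' := congrArg F'.map (map_coverπ_comp_toNgp f)
  rw [Functor.map_comp] at e e'
  refine e.trans (h₂.trans ?_)
  rw [← e', h₁]
  exact eqToHom_conj_comp _ _ _ _ _ _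

/-- `P` has the strict universal property of the category of fractions. -/
noncomputable def strictUniversalProperty (C : Type*) [Category C] :
    Localization.StrictUniversalPropertyFixedTarget functorP.{u} excision.{u} C where
  inverts := isInvertedBy_functorP
  lift G hG := liftNgp G hG
  fac G hG := functorP_comp_liftNgp G hG
  uniq _ _ h := functorP_comp_injective h

/-! ### Exactness -/

theorem nullNgp_comp_left ⦃X Y Z : Ngp.{u}⦄ (φ : X ⟶ Y) (ψ : Y ⟶ Z) (h : nullNgp ψ) :
    nullNgp (φ ≫ ψ) := by
  obtain ⟨⟨X⟩⟩ := X
  obtain ⟨⟨Y⟩⟩ := Y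
  obtain ⟨⟨Z⟩⟩ := Z
  obtain ⟨f, rfl⟩ := exists_toNgp_eq φ
  obtain ⟨g, rfl⟩ := exists_toNgp_eq ψ
  have h := (nullNgp_toNgp_iff _).1 h
  exact (nullNgp_toNgp_iff (f.comp g)).2 fun s => h (f.toFun s)

theorem nullNgp_comp_right ⦃X Y Z : Ngp.{u}⦄ (φ : X ⟶ Y) (ψ : Y ⟶ Z) (h : nullNgp φ) :
    nullNgp (φ ≫ ψ) := by
  obtain ⟨⟨X⟩⟩ := X
  obtain ⟨⟨Y⟩⟩ := Y
  obtain ⟨⟨Z⟩⟩ := Z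
  obtain ⟨f, rfl⟩ := exists_toNgp_eq φ
  obtain ⟨g, rfl⟩ := exists_toNgp_eq ψ
  have h := (nullNgp_toNgp_iff _).1 h
  exact (nullNgp_toNgp_iff (f.comp g)).2 fun s => g.sub_le_preimage (h s)

instance : nullNgp.{u}.RespectsIso := respectsIso_of_ideal nullNgp_comp_left nullNgp_comp_right

/-- A quasi-homomorphism with values in `f⁻¹(T₀)` corestricts, since words are computed alike in a
subgroup. Uniqueness holds because the congruence on the kernel is the restricted one. -/
theorem isKernel_functorP_map_kerι {X Y : GroupPair.{u}} (f : X ⟶ Y) :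
    IsKernel nullNgp (functorP.map (kerι f)) (functorP.map f) where
  null := by
    rw [← functorP.map_comp, nullNgp_functorP_map_iff]
    exact (isKernel_kerι f).null
  lift A α hα := by
    obtain ⟨⟨A⟩⟩ := A
    obtain ⟨a, rfl⟩ := exists_toNgp_eq α
    have ha : ∀ s, a.toFun s ∈ GroupPair.preimage f :=
      (nullNgp_toNgp_iff (a.comp (QuasiHom.ofHom f))).1 hα
    let b : QuasiHom A (ker f) := QuasiHom.ofLift (fun s => ⟨a.toFun s, ha s⟩) fun w hw => by
      have e : FreeGroup.lift a.toFun = (GroupPair.preimage f).subtype.comp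
          (FreeGroup.lift fun s => (⟨a.toFun s, ha s⟩ : GroupPair.preimage f)) :=
        FreeGroup.ext_hom _ _ fun s => by simp
      have := a.lift_mem w hw
      rw [e] at this
      exact this
    refine ⟨b.toNgp, (toNgp_comp b (QuasiHom.ofHom (kerι f))).symm, fun β hβ => ?_⟩
    obtain ⟨b', rfl⟩ := exists_toNgp_eq β
    have h := toNgp_eq_iff.1 ((toNgp_comp b' (QuasiHom.ofHom (kerι f))).trans hβ)
    exact toNgp_eq_iff.2 fun s => h s

/-- The same mapping `a` serves as factorisation: its preimage of the null subgroup is itself a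
subgroup, so it contains the join as soon as it contains `T₀` and `f(S)`. -/
theorem isCokernel_functorP_map_cokerπ {X Y : GroupPair.{u}} (f : X ⟶ Y) :
    IsCokernel nullNgp (functorP.map (cokerπ f)) (functorP.map f) where
  null := by
    rw [← functorP.map_comp, nullNgp_functorP_map_iff]
    exact (isCokernel_cokerπ f).null
  desc A α hα := by
    obtain ⟨⟨A⟩⟩ := A
    obtain ⟨a, rfl⟩ := exists_toNgp_eq α
    have ha : ∀ s, GroupPair.Hom.toMonoidHom f s ∈ a.preimage :=
      (nullNgp_toNgp_iff ((QuasiHom.ofHom f).comp a)).1 hα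
    have hle : Y.sub ⊔ (GroupPair.Hom.toMonoidHom f).range ≤ a.preimage := by
      refine sup_le a.sub_le_preimage ?_
      rintro _ ⟨s, rfl⟩
      exact ha s
    let b : QuasiHom (coker f) A := QuasiHom.ofLift (X := coker f) a.toFun
      fun w hw => (a.lift_mem_iff w).2 (hle hw)
    refine ⟨b.toNgp, (toNgp_comp (QuasiHom.ofHom (cokerπ f)) b).symm, fun β hβ => ?_⟩
    obtain ⟨b', rfl⟩ := exists_toNgp_eq β
    have h := toNgp_eq_iff.1 ((toNgp_comp (QuasiHom.ofHom (cokerπ f)) b').trans hβ)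
    exact toNgp_eq_iff.2 fun s => h s

theorem isExact_functorP : IsExact nullGroupPair.{u} nullNgp.{u} functorP.{u} :=
  ⟨isLeftExact_of_exists_kernel fun _ _ f => ⟨_, _, isKernel_kerι f, isKernel_functorP_map_kerι f⟩,
    isRightExact_of_exists_cokernel fun _ _ f =>
      ⟨_, _, isCokernel_cokerπ f, isCokernel_functorP_map_cokerπ f⟩⟩

theorem isSemiexact_nullNgp : IsSemiexact nullNgp.{u} :=
  isSemiexact_nullGroupPair.of_liftsMorphisms nullNgp_comp_left nullNgp_comp_right
    nullNgp_functorP_map_iff isExact_functorP liftsMorphisms_functorP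

/-- The composite `α ≫ φ` is null exactly when a representative of `α` takes values in the preimage
subgroup of a representative of `φ`; so this subgroup determines the kernel of `φ`. -/
theorem hasSmallNormalSubobjects_nullNgp : HasSmallNormalSubobjects.{u} nullNgp.{u} := by
  refine hasSmallNormalSubobjects_of_invariant (fun X => Subgroup X.as.pair.carrier)
    (fun {X Y} φ => (exists_toNgp_eq (X := X.as.pair) (Y := Y.as.pair) φ).choose.preimage) ?_
  rintro ⟨⟨X⟩⟩ ⟨⟨Y⟩⟩ ⟨⟨Y'⟩⟩ φ φ' h ⟨⟨A⟩⟩ α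
  obtain ⟨a, rfl⟩ := exists_toNgp_eq α
  have key : ∀ (Z : GroupPair.{u}) (ψ : functorP.obj X ⟶ functorP.obj Z),
      nullNgp (a.toNgp ≫ ψ) ↔ ∀ s, a.toFun s ∈ (exists_toNgp_eq ψ).choose.preimage := by
    intro Z ψ
    conv_lhs => rw [← (exists_toNgp_eq ψ).choose_spec, ← toNgp_comp]
    exact nullNgp_toNgp_iff _
  refine (key Y φ).trans (Iff.trans ?_ (key Y' φ').symm)
  exact forall_congr' fun s => SetLike.ext_iff.1 h (a.toFun s)

/-- `Q` stands for a kind of exactness. It has to be checked on the factorisation only, as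
uniqueness already holds among all functors. -/
theorem existsUnique_lift {C : Type*} [Category C] {G : GroupPair.{u} ⥤ C}
    (hG : excision.IsInvertedBy G) (Q : (Ngp.{u} ⥤ C) → Prop)
    (hQ : ∀ G' : Ngp.{u} ⥤ C, functorP ⋙ G' = G → Q G') :
    ∃! G' : Ngp.{u} ⥤ C, Q G' ∧ functorP ⋙ G' = G :=
  have h := functorP_comp_liftNgp G hG
  ⟨liftNgp G hG, ⟨hQ _ h, h⟩, fun _ h' => functorP_comp_injective (h'.2.trans h.symm)⟩

end NormalisedGroups

theorem theorem4p6 :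
    -- `P` is the category of fractions of `Gp₂` with respect to the excision maps,
    functorP.{u}.IsLocalization excision.{u} ∧
    -- with the strict universal property: `P` inverts these maps, and every functor inverting
    -- them factors uniquely through `P`
    excision.{u}.IsInvertedBy functorP.{u} ∧
    (∀ (C : Type v) [Category.{w} C] (G : GroupPair.{u} ⥤ C), excision.{u}.IsInvertedBy G →
      ∃! G' : Ngp.{u} ⥤ C, functorP.{u} ⋙ G' = G) ∧
    -- `Gp₂` and `Ngp` are semiexact and `P` is exact
    (IsSemiexact nullGroupPair.{u} ∧ HasSmallNormalSubobjects.{u} nullGroupPair.{u}) ∧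
    (IsSemiexact nullNgp.{u} ∧ HasSmallNormalSubobjects.{u} nullNgp.{u}) ∧
    IsExact nullGroupPair.{u} nullNgp.{u} functorP.{u} ∧
    -- the universal property within semiexact categories and
    -- exact / left exact / right exact / short exact functors
    (∀ (C : Type v) [Category.{w} C] (N : MorphismProperty C), IsSemiexact N →
      ∀ G : GroupPair.{u} ⥤ C, excision.{u}.IsInvertedBy G →
        (IsExact nullGroupPair.{u} N G →
          ∃! G' : Ngp.{u} ⥤ C, IsExact nullNgp.{u} N G' ∧ functorP.{u} ⋙ G' = G) ∧
        (IsLeftExact nullGroupPair.{u} N G →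
          ∃! G' : Ngp.{u} ⥤ C, IsLeftExact nullNgp.{u} N G' ∧ functorP.{u} ⋙ G' = G) ∧
        (IsRightExact nullGroupPair.{u} N G →
          ∃! G' : Ngp.{u} ⥤ C, IsRightExact nullNgp.{u} N G' ∧ functorP.{u} ⋙ G' = G) ∧
        (PreservesShortExact nullGroupPair.{u} N G →
          ∃! G' : Ngp.{u} ⥤ C,
            PreservesShortExact nullNgp.{u} N G' ∧ functorP.{u} ⋙ G' = G)) := by
  refine ⟨.mk' _ _ (strictUniversalProperty _) (strictUniversalProperty _), isInvertedBy_functorP,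
    fun C _ G hG => ?_, ⟨isSemiexact_nullGroupPair, hasSmallNormalSubobjects_nullGroupPair⟩,
    ⟨isSemiexact_nullNgp, hasSmallNormalSubobjects_nullNgp⟩, isExact_functorP,
    fun C _ N hN G hG => ?_⟩
  · simpa using existsUnique_lift hG (fun _ => True) fun _ _ => trivial
  · have := respectsIso_of_ideal hN.comp_left hN.comp_right
    have hl : IsLeftExact nullGroupPair N G →
        ∀ G' : Ngp.{u} ⥤ C, functorP ⋙ G' = G → IsLeftExact nullNgp N G' := by
      rintro h G' rfl
      exact IsLeftExact.of_comp isSemiexact_nullGroupPair isExact_functorP.1 liftsMorphisms_functorP h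
    have hr : IsRightExact nullGroupPair N G →
        ∀ G' : Ngp.{u} ⥤ C, functorP ⋙ G' = G → IsRightExact nullNgp N G' := by
      rintro h G' rfl
      exact IsRightExact.of_comp isSemiexact_nullGroupPair isExact_functorP.2 liftsMorphisms_functorP h
    refine ⟨fun h => existsUnique_lift hG _ fun G' h' => ⟨hl h.1 G' h', hr h.2 G' h'⟩,
      fun h => existsUnique_lift hG _ (hl h), fun h => existsUnique_lift hG _ (hr h),
      fun h => existsUnique_lift hG _ ?_⟩
    rintro G' rfl
    exact h.of_comp isSemiexact_nullGroupPair isExact_functorP liftsMorphisms_functorP
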